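/- Let $k\ge 0$ and $n\ge 2k+1$ be integers, and let $X_{n,k}$ be the set of bitstrings of length $n$ with exactly $k$ many 1s. Strings $x\in X_{n,k}$ are considered cyclically (positions modulo $n$), and $\widehat x$ denotes the bi-infinite $n$-periodic string obtained by unrolling $x$. For a bitstring $y$, $\overline{y}$ denotes its bitwise complement. **Matching and cycles.** Match each 1 of $x$ to the last bit, a 0, of the shortest cyclic substring that starts at this 1, goes to the right, and contains equally many 1s and 0s. Let $f(x)$ be obtained from $x$ by complementing all matched bits, and let $C(x)=(x,f(x),f^2(x),\ldots)$ be the cycle of $x$. Let $d(x)$ be the number of cyclic occurrences of the substring $10$ in $x$ (the descents). **Gliders.** Let $D$ be the set of Dyck words, i.e., bitstrings (possibly empty) with equally many 1s and 0s in which every prefix has at least as many 1s as 0s, and let $D'\subseteq D$ be the set of words $1\,u\,0$ with $u\in D$. Interpret $\widehat x$ as a Motzkin path, with an up-step for every matched 1, a down-step for every matched 0, and a flat step for every unmatched 0, where the flat steps lie at height $0$. For a substring $y\in D$ of $\widehat x$ (or of the complement of a substring of $\widehat x$) we define recursively a set $\Gamma(y)$ of pairs $(A,B)$ of finite sets of positions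 (positions are always those in $\widehat x$): - $\Gamma(\varepsilon)=\emptyset$, and if $y=y_1\cdots y_\ell$ with $y_1,\ldots,y_\ell\in D'$, then $\Gamma(y)=\bigcup_i\Gamma(y_i)$. - If $y\in D'$ has height $h$ (the maximum over all prefixes of the number of 1s minus the number of 0s), then write $y$ uniquely as $y=1\,0$ if $h=1$, and as $$y=1\,u_1\,1\,u_2\cdots 1\,u_{h-2}\,1\,1\,v_0\,0\,v_1\,0\cdots 0\,v_{h-2}\,0\,0$$ if $h\ge 2$, where $u_1,\ldots,u_{h-2},\overline{v_0},\ldots,\overline{v_{h-2}}\in D$ and $v_0$ starts at the leftmost highest point of $y$. Then $$\Gamma(y)=\bigcup_{i=1}^{h-2}\Gamma(u_i)\cup\bigcup_{i=0}^{h-2}\Gamma(\overline{v_i})\cup\{(A,B)\},$$ where $A$ and $B$ are the sets of positions of the 1s and of the 0s of $y$, respectively, that belong to none of the $u_i$ and $v_i$. Let $\Gamma(x)$ be the union of the sets $\Gamma(y)$ over all substrings $y\in D$ of $\widehat x$ that start and end at height $0$ of the Motzkin path. The elements of $\Gamma(x)$ are called gliders. Two gliders $(A,B)$ and $(A',B')$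 are equivalent if $A$ and $A'$ are the same sets modulo $n$, and $B$ and $B'$ are the same sets modulo $n$. The number of gliders $\nu(x)$ is the number of equivalence classes of $\Gamma(x)$. **Lemma.** For every $x\in X_{n,k}$ we have $d(x)=\nu(x)$. Moreover, for every $y$ on the cycle $C(x)$ we have $\nu(x)=\nu(y)$ and consequently $d(x)=d(y)$, i.e., the number of descents is invariant along each cycle. -/

import Mathlib

namespace KneserGliders

/-- `bitstrings n k` is `X_{n,k}`: the bitstrings of length `n` with exactly `k` many 1s. Positions
are taken modulo `n`, and `true`, `false` stand for the bits 1, 0. -/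
def bitstrings (n k : ℕ) : Set (ZMod n → Bool) :=
  {x | {i | x i = true}.ncard = k}

/-- The bi-infinite string obtained by unrolling the cyclic string `x`. -/
def unroll {n : ℕ} (x : ZMod n → Bool) : ℤ → Bool := fun i => x (i : ZMod n)

/-- Bitwise complement. -/
def compl (w : ℤ → Bool) : ℤ → Bool := fun i => !(w i)

/-- Number of 1s minus number of 0s among the bits at the positions `a + 1, …, b`. The substring on
these positions is the one "from the point `a` to the point `b`": step `i` joins point `i - 1` to
point `i`. -/
noncomputable def balance (w : ℤ → Bool) (a b : ℤ) : ℤ :=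
  ∑ i ∈ Finset.Ioc a b, if w i = true then 1 else -1

/-! ### Parenthesis matching and the map `f` -/

/-- The 1-bit at position `i` is matched to the bit at position `j`: the substring on the positions
`i, …, j` is the shortest substring starting at `i` that has as many 0s as 1s. -/
def MatchedPair (w : ℤ → Bool) (i j : ℤ) : Prop :=
  w i = true ∧ i < j ∧ balance w (i - 1) j = 0 ∧
    ∀ j', i ≤ j' → j' < j → balance w (i - 1) j' ≠ 0

/-- Positions of the matched bits of a bi-infinite string. -/
def matched (w : ℤ → Bool) : Set ℤ := {i | ∃ j, MatchedPair w i j ∨ MatchedPair w j i}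

/-- `μ(x)`: positions (modulo `n`) of the matched bits of the cyclic string `x`. -/
def cyclicMatched {n : ℕ} (x : ZMod n → Bool) : Set (ZMod n) :=
  {r | ∃ i : ℤ, (i : ZMod n) = r ∧ i ∈ matched (unroll x)}

open Classical in
/-- The map `f`: complement all matched bits. -/
noncomputable def f {n : ℕ} (x : ZMod n → Bool) : ZMod n → Bool :=
  fun r => if r ∈ cyclicMatched x then !(x r) else x r

/-- The strings on the cycle `C(x) = (x, f(x), f²(x), …)`. -/
def cycle {n : ℕ} (x : ZMod n → Bool) : Set (ZMod n → Bool) := {y | ∃ t : ℕ, y = f^[t] x}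

/-- `d(x)`: the number of cyclic occurrences of the substring `10`. -/
noncomputable def descents {n : ℕ} (x : ZMod n → Bool) : ℕ :=
  {i : ZMod n | x i = true ∧ x (i + 1) = false}.ncard

/-! ### The Motzkin path -/

open Classical in
/-- The steps of the Motzkin path: up for a matched 1, down for a matched 0, and flat for an
unmatched bit. -/
noncomputable def motzkinStep (w : ℤ → Bool) (i : ℤ) : ℤ :=
  if i ∈ matched w then (if w i = true then 1 else -1) else 0

/-- Position of the first unmatched bit of `x`, among the positions `1, 2, …`. -/
noncomputable def firstUnmatched {n : ℕ} (x : ZMod n → Bool) : ℕ :=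
  sInf {i : ℕ | 1 ≤ i ∧ (i : ℤ) ∉ matched (unroll x)}

/-- Ordinate of the Motzkin path of `x` (extended periodically) at abscissa `p`, normalized such
that the first flat step starts at ordinate 0. -/
noncomputable def motzkinHeight {n : ℕ} (x : ZMod n → Bool) (p : ℤ) : ℤ :=
  (∑ i ∈ Finset.Ioc ((firstUnmatched x : ℤ) - 1) p, motzkinStep (unroll x) i) -
    ∑ i ∈ Finset.Ioc p ((firstUnmatched x : ℤ) - 1), motzkinStep (unroll x) i

/-! ### Hills and their decomposition -/

/-- The substring of `w` from point `a` to point `b` is a Dyck word (lies in `D`). -/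
def IsDyck (w : ℤ → Bool) (a b : ℤ) : Prop :=
  a ≤ b ∧ balance w a b = 0 ∧ ∀ q, a ≤ q → q ≤ b → 0 ≤ balance w a q

/-- The substring of `w` from point `a` to point `b` lies in `D'`: it is a nonempty Dyck word with
strictly more 1s than 0s in every nonempty proper prefix. -/
def IsPrimeDyck (w : ℤ → Bool) (a b : ℤ) : Prop :=
  a < b ∧ balance w a b = 0 ∧ ∀ q, a < q → q < b → 0 < balance w a q

/-- The point `p` is the leftmost highest point of the path from point `a` to point `b`. -/
def IsLeftmostPeak (w : ℤ → Bool) (a b p : ℤ) : Prop :=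
  a ≤ p ∧ p ≤ b ∧ (∀ q, a ≤ q → q ≤ b → balance w a q ≤ balance w a p) ∧
    ∀ q, a ≤ q → q < p → balance w a q < balance w a p

/-- The decomposition of a hill `y ∈ D'` of height `h`, lying between the points `a` and `b`, as
`y = 1 0` if `h = 1`, and as
`y = 1 u₁ 1 u₂ ⋯ 1 u_{h-2} 1 1 v₀ 0 v₁ 0 ⋯ 0 v_{h-2} 0 0` if `h ≥ 2`, where the `uᵢ` (the bulges)
and the complements of the `vᵢ` (the dents) are Dyck words, and `v₀` starts at the leftmost highest
point of `y`. Here `c 1 < ⋯ < c h` and `d 1 < ⋯ < d h` are the positions of the displayed 1s and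
0s; `d 0 = c h` by convention. So `uᵢ` lies between the points `c i` and `c (i + 1) - 1`, and `vᵢ`
lies between the points `d i` and `d (i + 1) - 1`. -/
structure HillDecomposition (w : ℤ → Bool) (a b : ℤ) (h : ℕ) (c d : ℕ → ℤ) : Prop where
  prime : IsPrimeDyck w a b
  pos : 1 ≤ h
  peak : IsLeftmostPeak w a b (c h)
  height : balance w a (c h) = h
  first : c 1 = a + 1
  mid : d 0 = c h
  last : d h = b
  ones : ∀ i, 1 ≤ i → i ≤ h → w (c i) = true
  zeros : ∀ i, 1 ≤ i → i ≤ h → w (d i) = false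
  bulge : ∀ i, 1 ≤ i → i + 2 ≤ h → IsDyck w (c i) (c (i + 1) - 1)
  dent : ∀ i, i + 2 ≤ h → IsDyck (compl w) (d i) (d (i + 1) - 1)
  final_one : ∀ i, 1 ≤ i → i + 1 = h → c (i + 1) = c i + 1
  final_zero : ∀ i, i + 1 = h → d (i + 1) = d i + 1

/-! ### Gliders -/

/-- `GliderIn w a b A B` says `(A, B) ∈ Γ(y)` for the hill `y` of `w` between the points `a` and
`b`. A hill in `D` has the gliders of its factors in `D'`. A hill in `D'` has one glider of its own,
consisting of the steps outside its bulges and dents, together with the gliders of its bulges and of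
its complemented dents. -/
inductive GliderIn : (ℤ → Bool) → ℤ → ℤ → Finset ℤ → Finset ℤ → Prop
  | factor {w : ℤ → Bool} {a a' b' b : ℤ} {A B : Finset ℤ} :
      IsDyck w a a' → IsPrimeDyck w a' b' → IsDyck w b' b →
      GliderIn w a' b' A B → GliderIn w a b A B
  | own {w : ℤ → Bool} {a b : ℤ} {h : ℕ} {c d : ℕ → ℤ} :
      HillDecomposition w a b h c d →
      GliderIn w a b ((Finset.Icc 1 h).image c) ((Finset.Icc 1 h).image d)
  | bulge {w : ℤ → Bool} {a b : ℤ} {h : ℕ} {c d : ℕ → ℤ} {A B : Finset ℤ} (i : ℕ) :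
      HillDecomposition w a b h c d → 1 ≤ i → i + 2 ≤ h →
      GliderIn w (c i) (c (i + 1) - 1) A B → GliderIn w a b A B
  | dent {w : ℤ → Bool} {a b : ℤ} {h : ℕ} {c d : ℕ → ℤ} {A B : Finset ℤ} (i : ℕ) :
      HillDecomposition w a b h c d → i + 2 ≤ h →
      GliderIn (compl w) (d i) (d (i + 1) - 1) A B → GliderIn w a b A B

/-- A base hill: a Dyck subpath of the unrolled string that starts and ends at the abscissa. -/
def IsBaseHill {n : ℕ} (x : ZMod n → Bool) (a b : ℤ) : Prop :=
  IsDyck (unroll x) a b ∧ motzkinHeight x a = 0 ∧ motzkinHeight x b = 0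

/-- `Γ(x)`: the set of all gliders `(A, B)` of `x`. -/
def gliders {n : ℕ} (x : ZMod n → Bool) : Set (Finset ℤ × Finset ℤ) :=
  {γ | ∃ a b, IsBaseHill x a b ∧ GliderIn (unroll x) a b γ.1 γ.2}

/-- The set of residues modulo `n` of a finite set of integers. -/
def residues (n : ℕ) (A : Finset ℤ) : Set (ZMod n) := (fun i : ℤ => (i : ZMod n)) '' (A : Set ℤ)

/-- `(A, B) ∼ (A', B')` if these sets are the same modulo `n`. -/
def gliderSetoid {n : ℕ} (x : ZMod n → Bool) : Setoid (gliders x) where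
  r γ γ' := residues n γ.1.1 = residues n γ'.1.1 ∧ residues n γ.1.2 = residues n γ'.1.2
  iseqv :=
    { refl := fun _ => ⟨rfl, rfl⟩
      symm := fun h => ⟨h.1.symm, h.2.symm⟩
      trans := fun h h' => ⟨h.1.trans h'.1, h.2.trans h'.2⟩ }

/-- `ν(x)`: the number of gliders, i.e. of equivalence classes of `Γ(x)`. -/
noncomputable def numGliders {n : ℕ} (x : ZMod n → Bool) : ℕ :=
  Nat.card (Quotient (gliderSetoid x))

end KneserGliders

namespace KneserGliders

/-! ### Signed sums and the height function -/

/-! Descents and gliders satisfy the same recursion. A hill in `D'` has one glider of its own, plus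
those of its bulges and complemented dents. Its descents are the one at the leftmost peak, plus
those of its bulges and complemented dents: a dent is entered and left by a 0, so it accounts for
equally many `10` and `01`, and the latter are the descents of the complement. The two recursions
are `HillDecomposition.card_hillGliders` and `HillDecomposition.descentSum_sub`; induction on the
length gives `card_hillGliders`. For the glider side to be an exact count, the decomposition must
exist (`exists_hillDecomposition`) and be unique (`HillDecomposition.unique`).

To pass to the whole cyclic string, note that the height changes by `2k - n < 0` per period. Hence
the unmatched bits are exactly the steps to a new strict minimum (`mem_matched_iff`), and the
Motzkin path is at height 0 exactly where the height is a minimum so far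
(`motzkinHeight_eq_zero_iff`). No base hill crosses an unmatched step, so a window of length `n` cut
before such a step contains exactly one representative of each glider class (`numGliders_eq_card`);
between its ends, gliders and descents agree (`card_groundGliders`).

Invariance is proved for descents and then transferred to gliders. The 1s of `f x` are the matched
0s of `x`, and these form runs, each starting immediately after a descent of `x`. So the runs of 1s
in `f x` are counted by the descents of `x` (`descents_f`). -/

/-- The sum of `g` over the steps from the point `c` to the point `p`, with sign. -/
noncomputable def signedSum (g : ℤ → ℤ) (c p : ℤ) : ℤ :=
  (∑ i ∈ Finset.Ioc c p, g i) - ∑ i ∈ Finset.Ioc p c, g i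

lemma sum_Ioc_eq_sub {g H : ℤ → ℤ} (hH : ∀ p, H (p + 1) = H p + g (p + 1)) {c p : ℤ}
    (h : c ≤ p) : ∑ i ∈ Finset.Ioc c p, g i = H p - H c := by
  induction p, h using Int.leInduction with
  | base => simp
  | succ p hp ih =>
    have : Finset.Ioc c (p + 1) = insert (p + 1) (Finset.Ioc c p) := by
      ext i; simp only [Finset.mem_Ioc, Finset.mem_insert]; omega
    rw [this, Finset.sum_insert (by simp), ih, hH]; ring

/-- Primitives of `g` are unique up to a constant. This identifies the Motzkin height and the
heights of complemented or shifted strings without recomputing sums. -/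
lemma signedSum_eq_sub {g H : ℤ → ℤ} (hH : ∀ p, H (p + 1) = H p + g (p + 1)) (c p : ℤ) :
    signedSum g c p = H p - H c := by
  unfold signedSum
  rcases le_total c p with h | h
  · rw [Finset.Ioc_eq_empty (a := p) (by omega), sum_Ioc_eq_sub hH h]; simp
  · rw [Finset.Ioc_eq_empty (a := c) (by omega), sum_Ioc_eq_sub hH h]; simp

lemma signedSum_succ (g : ℤ → ℤ) (c p : ℤ) :
    signedSum g c (p + 1) = signedSum g c p + g (p + 1) := by
  unfold signedSum
  rcases le_or_gt c p with h | h
  · have : Finset.Ioc c (p + 1) = insert (p + 1) (Finset.Ioc c p) := by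
      ext i; simp only [Finset.mem_Ioc, Finset.mem_insert]; omega
    rw [this, Finset.sum_insert (by simp), Finset.Ioc_eq_empty (a := p) (by omega),
      Finset.Ioc_eq_empty (a := p + 1) (by omega)]
    simp; ring
  · have : Finset.Ioc p c = insert (p + 1) (Finset.Ioc (p + 1) c) := by
      ext i; simp only [Finset.mem_Ioc, Finset.mem_insert]; omega
    rw [this, Finset.sum_insert (by simp), Finset.Ioc_eq_empty (a := c) (by omega),
      Finset.Ioc_eq_empty (a := c) (by omega)]
    simp

/-- Height of the path with an up-step for each 1 and a down-step for each 0. -/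
noncomputable def height (w : ℤ → Bool) (p : ℤ) : ℤ :=
  signedSum (fun i => if w i = true then 1 else -1) 0 p

lemma height_succ (w : ℤ → Bool) (p : ℤ) :
    height w (p + 1) = height w p + if w (p + 1) = true then 1 else -1 :=
  signedSum_succ _ _ _

lemma height_of_true {w : ℤ → Bool} {i : ℤ} (h : w i = true) :
    height w i = height w (i - 1) + 1 := by
  have := height_succ w (i - 1)
  simpa [h] using this

lemma height_of_false {w : ℤ → Bool} {i : ℤ} (h : w i = false) :
    height w i = height w (i - 1) - 1 := by
  have := height_succ w (i - 1)
  simpa [h, sub_eq_add_neg] using this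

lemma step_cases (w : ℤ → Bool) (i : ℤ) :
    w i = true ∧ height w i = height w (i - 1) + 1 ∨
      w i = false ∧ height w i = height w (i - 1) - 1 := by
  cases h : w i
  · exact .inr ⟨rfl, height_of_false h⟩
  · exact .inl ⟨rfl, height_of_true h⟩

lemma balance_eq (w : ℤ → Bool) {a b : ℤ} (h : a ≤ b) :
    balance w a b = height w b - height w a :=
  sum_Ioc_eq_sub (height_succ w) h

lemma height_compl (w : ℤ → Bool) (p : ℤ) : height (compl w) p = -height w p := by
  unfold height
  rw [signedSum_eq_sub (H := fun p => -height w p)]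
  · simp [height, signedSum]
  · intro p
    rcases Bool.eq_false_or_eq_true (w (p + 1)) with h | h <;>
      simp [height_succ, compl, h] <;> ring

/-- With heights in place of balances, statements about Dyck words become linear inequalities
between values of one function. -/
lemma isDyck_iff {w : ℤ → Bool} {a b : ℤ} : IsDyck w a b ↔
    a ≤ b ∧ height w b = height w a ∧ ∀ q, a ≤ q → q ≤ b → height w a ≤ height w q := by
  unfold IsDyck
  refine and_congr_right fun hab => and_congr ?_ ?_
  · rw [balance_eq w hab]; omega
  · refine forall_congr' fun q => forall_congr' fun h => ?_
    rw [balance_eq w h]; omega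

lemma isPrimeDyck_iff {w : ℤ → Bool} {a b : ℤ} : IsPrimeDyck w a b ↔
    a < b ∧ height w b = height w a ∧ ∀ q, a < q → q < b → height w a < height w q := by
  unfold IsPrimeDyck
  refine and_congr_right fun hab => and_congr ?_ ?_
  · rw [balance_eq w hab.le]; omega
  · refine forall_congr' fun q => forall_congr' fun h => ?_
    rw [balance_eq w h.le]; omega

lemma isDyck_compl_iff {w : ℤ → Bool} {a b : ℤ} : IsDyck (compl w) a b ↔
    a ≤ b ∧ height w b = height w a ∧ ∀ q, a ≤ q → q ≤ b → height w q ≤ height w a := by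
  simp [isDyck_iff, height_compl]

lemma isDyck_self (w : ℤ → Bool) (a : ℤ) : IsDyck w a a :=
  isDyck_iff.2 ⟨le_rfl, rfl, fun q h h' => by rw [le_antisymm h h']⟩

lemma IsPrimeDyck.isDyck {w : ℤ → Bool} {a b : ℤ} (h : IsPrimeDyck w a b) : IsDyck w a b := by
  rw [isPrimeDyck_iff] at h
  refine isDyck_iff.2 ⟨h.1.le, h.2.1, fun q hq hq' => ?_⟩
  rcases hq.eq_or_lt with rfl | hq
  · exact le_rfl
  rcases hq'.eq_or_lt with rfl | hq'
  · exact h.2.1.ge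
  · exact (h.2.2 q hq hq').le

lemma IsDyck.first {w : ℤ → Bool} {a b : ℤ} (h : IsDyck w a b) (hab : a < b) :
    w (a + 1) = true := by
  rw [isDyck_iff] at h
  have h1 := h.2.2 (a + 1) (by omega) (by omega)
  rcases step_cases w (a + 1) with h2 | h2
  · exact h2.1
  · simp only [add_sub_cancel_right] at h2; omega

/-- First return: a 1 after the point `a` starts a prime Dyck word if the path comes back. -/
lemma exists_isPrimeDyck {w : ℤ → Bool} {a b : ℤ} (hw : w (a + 1) = true) (hab : a < b)
    (h : height w b ≤ height w a) : ∃ m, m ≤ b ∧ IsPrimeDyck w a m := by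
  obtain ⟨m, ⟨hm1, hm2⟩, hm3⟩ := Int.exists_least_of_bdd
    (P := fun m => a < m ∧ height w m ≤ height w a) ⟨a, fun z hz => hz.1.le⟩ ⟨b, hab, h⟩
  refine ⟨m, hm3 b ⟨hab, h⟩, isPrimeDyck_iff.2 ⟨hm1, ?_, fun q hq hq' => ?_⟩⟩
  · have h1 := height_of_true hw
    simp only [add_sub_cancel_right] at h1
    have h2 : a + 1 ≠ m := by rintro rfl; omega
    have h3 : ¬ height w (m - 1) ≤ height w a := fun h' => by
      have := hm3 (m - 1) ⟨by omega, h'⟩; omega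
    rcases step_cases w m with h4 | h4 <;> omega
  · by_contra hc
    have := hm3 q ⟨hq, by omega⟩
    omega

/-- A last ascent: if the path is higher at `b` than at `a`, then a 1 after `a` is followed by a
Dyck word that ends at `b`. -/
lemma exists_last_ascent {w : ℤ → Bool} {a b : ℤ} (hab : a ≤ b) (h : height w a < height w b) :
    ∃ r, a < r ∧ w r = true ∧ IsDyck w r b := by
  obtain ⟨m, ⟨hm1, hm2⟩, hm3⟩ := Int.exists_greatest_of_bdd
    (P := fun m => m ≤ b ∧ height w m < height w b) ⟨b, fun z hz => hz.1⟩ ⟨a, hab, h⟩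
  have h0 : m ≠ b := by rintro rfl; omega
  have h1 : ∀ q, m < q → q ≤ b → height w b ≤ height w q := fun q hq hq' => by
    by_contra hc
    have := hm3 q ⟨hq', by omega⟩
    omega
  have h2 := h1 (m + 1) (by omega) (by omega)
  have h3 := hm3 a ⟨hab, h⟩
  rcases step_cases w (m + 1) with ⟨h4, h5⟩ | ⟨h4, h5⟩ <;> simp only [add_sub_cancel_right] at h5
  · refine ⟨m + 1, by omega, h4, isDyck_iff.2 ⟨by omega, by omega, fun q hq hq' => ?_⟩⟩
    have := h1 q (by omega) hq'
    omega
  · omega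

/-- Every path from its lowest point up by `h` is `u₀ 1 u₁ 1 ⋯ 1 u_h` with Dyck words `uᵢ`. -/
lemma exists_staircase {w : ℤ → Bool} {a : ℤ} (h : ℕ) : ∀ {b : ℤ}, a ≤ b →
    height w b = height w a + h → (∀ q, a ≤ q → q ≤ b → height w a ≤ height w q) →
    ∃ c : ℕ → ℤ, c 0 = a ∧ (∀ i < h, IsDyck w (c i) (c (i + 1) - 1) ∧ w (c (i + 1)) = true) ∧
      IsDyck w (c h) b := by
  induction h with
  | zero =>
    intro b hab hb hq
    exact ⟨fun _ => a, rfl, by simp, isDyck_iff.2 ⟨hab, by simpa using hb, hq⟩⟩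
  | succ h ih =>
    intro b hab hb hq
    push_cast at hb
    -- The staircase is built from the top: `r` is the last displayed 1, and the rest of it ends at
    -- `r - 1`, one level lower.
    obtain ⟨r, har, hr, hd⟩ := exists_last_ascent hab (w := w) (by omega)
    have hr' := height_of_true hr
    have hd' := isDyck_iff.1 hd
    obtain ⟨c, hc0, hc, hch⟩ := ih (b := r - 1) (by omega) (by omega)
      (fun q h1 h2 => hq q h1 (by omega))
    refine ⟨Function.update c (h + 1) r, by simpa using hc0, fun i hi => ?_, by simpa using hd⟩
    rcases (Nat.lt_succ_iff.1 hi).eq_or_lt with rfl | hi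
    · simpa [hr] using hch
    · rw [Function.update_of_ne (by omega), Function.update_of_ne (by omega)]
      exact hc i hi

lemma staircase_heights {w : ℤ → Bool} {c : ℕ → ℤ} {h : ℕ}
    (hc : ∀ i < h, IsDyck w (c i) (c (i + 1) - 1) ∧ w (c (i + 1)) = true) {i j : ℕ}
    (hij : i ≤ j) (hj : j ≤ h) :
    c i + (j - i : ℕ) ≤ c j ∧ height w (c j) = height w (c i) + (j - i : ℕ) := by
  induction j, hij using Nat.le_induction with
  | base => simp
  | succ j hij ih =>
    have h1 := ih (by omega)
    have h2 := hc j (by omega)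
    have h3 := height_of_true h2.2
    have h4 := isDyck_iff.1 h2.1
    omega

/-! ### Existence and uniqueness of the decomposition of a hill -/

/-- The staircase of `w` up to the leftmost peak `p` gives the bulges, and that of `compl w` from
`p` to `b` gives the dents. Primality and the choice of `p` force the remaining Dyck words of both
staircases to be empty. -/
lemma exists_hillDecomposition {w : ℤ → Bool} {a b : ℤ} (hab : IsPrimeDyck w a b) :
    ∃ h c d, HillDecomposition w a b h c d := by
  have hp := isPrimeDyck_iff.1 hab
  have hD := isDyck_iff.1 hab.isDyck
  obtain ⟨t, ht, htmax⟩ := Finset.exists_max_image (Finset.Icc a b) (height w)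
    ⟨a, by simp [hp.1.le]⟩
  simp only [Finset.mem_Icc] at ht htmax
  obtain ⟨p, ⟨hp1, hp2, hp3⟩, hp4⟩ := Int.exists_least_of_bdd
    (P := fun m => a ≤ m ∧ m ≤ b ∧ height w m = height w t) ⟨a, fun z hz => hz.1⟩
    ⟨t, ht.1, ht.2, rfl⟩
  have hpmax : ∀ q, a ≤ q → q ≤ b → height w q ≤ height w p := fun q h1 h2 => by
    rw [hp3]; exact htmax q ⟨h1, h2⟩
  have hpleft : ∀ q, a ≤ q → q < p → height w q < height w p := fun q h1 h2 => by
    have h3 := hpmax q h1 (by omega)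
    have h4 : height w q ≠ height w p := fun h4 => by
      have := hp4 q ⟨h1, by omega, by omega⟩; omega
    omega
  have hfirst := height_of_true (hab.isDyck.first hp.1)
  simp only [add_sub_cancel_right] at hfirst
  have hpa := hpmax (a + 1) (by omega) (by omega)
  obtain ⟨h, hh⟩ : ∃ h : ℕ, height w p = height w a + h :=
    ⟨(height w p - height w a).toNat, by omega⟩
  have hpb : p ≠ b := by rintro rfl; omega
  have hpa' : p ≠ a := by rintro rfl; omega
  obtain ⟨c, hc0, hc, hch⟩ := exists_staircase h hp1 hh
    (fun q h1 h2 => hD.2.2 q h1 (by omega))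
  obtain ⟨d, hd0, hd, hdh⟩ := exists_staircase (w := compl w) (a := p) (b := b) h (by omega)
    (by simp only [height_compl]; omega)
    (fun q h1 h2 => by simp only [height_compl]; have := hpmax q (by omega) h2; omega)
  have hcs := fun i hi => staircase_heights hc (i := i) (j := h) hi le_rfl
  have hcs0 := fun i hi => staircase_heights hc (i := 0) (j := i) (Nat.zero_le i) hi
  have hds := fun i hi => staircase_heights hd (i := 0) (j := i) (Nat.zero_le i) hi
  have hds' := fun i hi => staircase_heights hd (i := i) (j := h) hi le_rfl
  simp only [height_compl, hd0, hc0, Nat.sub_zero] at hds hds' hcs0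
  rw [isDyck_iff] at hch
  rw [isDyck_compl_iff] at hdh
  -- A nonempty last word would start at height `h`, left of the leftmost peak.
  have hchp : c h = p := by
    by_contra hne
    have h1 := (hcs0 h le_rfl)
    have := hpleft (c h) (by omega) (by omega)
    omega
  -- The point `d h` is at the height of `a`, which a prime word attains only at its ends.
  have hdhb : d h = b := by
    by_contra hne
    have h1 := hds h le_rfl
    have := hp.2.2 (d h) (by omega) (by omega)
    omega
  refine ⟨h, c, d, hab, by omega, ?_, ?_, ?_, hd0.trans hchp.symm, hdhb, ?_, ?_, ?_, ?_, ?_, ?_⟩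
  · rw [hchp]
    refine ⟨hp1, hp2, fun q h1 h2 => ?_, fun q h1 h2 => ?_⟩ <;> rw [balance_eq w hp1, balance_eq w h1]
    · have := hpmax q h1 h2; omega
    · have := hpleft q h1 h2; omega
  · rw [hchp, balance_eq w hp1]; omega
  · have h1 := isDyck_iff.1 (hc 0 (by omega)).1
    rw [hc0] at h1
    by_contra hne
    have h2 := hcs 1 (by omega)
    have := hp.2.2 (c (0 + 1) - 1) (by simp only [zero_add] at *; omega)
      (by simp only [zero_add] at *; omega)
    omega
  · intro i h1 h2
    obtain ⟨j, rfl⟩ : ∃ j, i = j + 1 := ⟨i - 1, by omega⟩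
    exact (hc j (by omega)).2
  · intro i h1 h2
    obtain ⟨j, rfl⟩ : ∃ j, i = j + 1 := ⟨i - 1, by omega⟩
    simpa [compl] using (hd j (by omega)).2
  · exact fun i _ hi => (hc i (by omega)).1
  · exact fun i hi => (hd i (by omega)).1
  · intro i h1 h2
    have h3 := (hc i (by omega)).1
    have h4 := isDyck_iff.1 h3
    -- A nonempty word here would start with a 1 and reach the maximal height before `p`.
    by_contra hne
    have h5 := height_of_true (h3.first (by omega))
    have h6 := hcs0 i (by omega)
    have h7 := hpleft (c i + 1) (by omega) (by rw [← hchp, ← h2]; omega)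
    simp only [add_sub_cancel_right] at h5
    omega
  · intro i h2
    have h3 := (hd i (by omega)).1
    have h4 := isDyck_compl_iff.1 h3
    -- A nonempty word here would start with a 0 and return to the height of `a` before `b`.
    by_contra hne
    have h5 := height_of_true (h3.first (by omega))
    have h6 := hds i (by omega)
    have h7 := hp.2.2 (d i + 1) (by omega) (by rw [← hdhb, ← h2]; omega)
    simp only [add_sub_cancel_right, height_compl] at h5
    omega

/-- All the bulges of a hill, including the empty one before its last displayed 1. -/
lemma HillDecomposition.bulge_of_lt {w : ℤ → Bool} {a b : ℤ} {h : ℕ} {c d : ℕ → ℤ}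
    (H : HillDecomposition w a b h c d) {i : ℕ} (hi : 1 ≤ i) (hih : i < h) :
    IsDyck w (c i) (c (i + 1) - 1) := by
  rcases Nat.lt_or_ge (i + 1) h with h1 | h1
  · exact H.bulge i hi h1
  · rw [H.final_one i hi (by omega)]; simpa using isDyck_self w (c i)

lemma HillDecomposition.dent_of_lt {w : ℤ → Bool} {a b : ℤ} {h : ℕ} {c d : ℕ → ℤ}
    (H : HillDecomposition w a b h c d) {i : ℕ} (hih : i < h) :
    IsDyck (compl w) (d i) (d (i + 1) - 1) := by
  rcases Nat.lt_or_ge (i + 1) h with h1 | h1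
  · exact H.dent i h1
  · rw [H.final_zero i (by omega)]; simpa using isDyck_self _ (d i)

lemma HillDecomposition.mono_ones {w : ℤ → Bool} {a b : ℤ} {h : ℕ} {c d : ℕ → ℤ}
    (H : HillDecomposition w a b h c d) {i j : ℕ} (hi : 1 ≤ i) (hij : i ≤ j) (hj : j ≤ h) :
    c i + (j - i : ℕ) ≤ c j := by
  induction j, hij using Nat.le_induction with
  | base => simp
  | succ j hij ih =>
    have h1 := ih (by omega)
    have h2 := (H.bulge_of_lt (i := j) (by omega) (by omega)).1
    omega

lemma HillDecomposition.mono_zeros {w : ℤ → Bool} {a b : ℤ} {h : ℕ} {c d : ℕ → ℤ}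
    (H : HillDecomposition w a b h c d) {i j : ℕ} (hij : i ≤ j) (hj : j ≤ h) :
    d i + (j - i : ℕ) ≤ d j := by
  induction j, hij using Nat.le_induction with
  | base => simp
  | succ j hij ih =>
    have h1 := ih (by omega)
    have h2 := (H.dent_of_lt (i := j) (by omega)).1
    omega

/-- Just before the later of the two 1s the path is one below its final height, which the longer
Dyck word forbids. -/
lemma eq_of_isDyck_of_true {w : ℤ → Bool} {r r' e : ℤ} (h : IsDyck w r e) (h' : IsDyck w r' e)
    (hr : w r = true) (hr' : w r' = true) : r = r' := by
  rw [isDyck_iff] at h h'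
  have h1 := height_of_true hr
  have h2 := height_of_true hr'
  rcases lt_trichotomy r r' with hlt | heq | hlt
  · have := h.2.2 (r' - 1) (by omega) (by omega); omega
  · exact heq
  · have := h'.2.2 (r - 1) (by omega) (by omega); omega

lemma IsLeftmostPeak.unique {w : ℤ → Bool} {a b p p' : ℤ} (h : IsLeftmostPeak w a b p)
    (h' : IsLeftmostPeak w a b p') : p = p' := by
  obtain ⟨h1, h2, h3, h4⟩ := h
  obtain ⟨h1', h2', h3', h4'⟩ := h'
  rcases lt_trichotomy p p' with hlt | heq | hlt
  · have := h4' p h1 hlt; have := h3 p' h1' h2'; omega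
  · exact heq
  · have := h4 p' h1' hlt; have := h3' p h1 h2; omega

/-- The last displayed 1 is at the leftmost peak and the last displayed 0 at `b`; downward induction
then determines each earlier position from the next one. -/
lemma HillDecomposition.unique {w : ℤ → Bool} {a b : ℤ} {h h' : ℕ} {c d c' d' : ℕ → ℤ}
    (H : HillDecomposition w a b h c d) (H' : HillDecomposition w a b h' c' d') :
    h = h' ∧ (∀ i, 1 ≤ i → i ≤ h → c i = c' i) ∧ ∀ i, i ≤ h → d i = d' i := by
  have hp := H.peak.unique H'.peak
  obtain rfl : h = h' := by
    have h1 := H.height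
    have h2 := H'.height
    rw [hp] at h1
    omega
  refine ⟨rfl, fun i h1 h2 => ?_, fun i h2 => ?_⟩
  · induction h2 using Nat.decreasingInduction with
    | self => exact hp
    | of_succ i hi ih =>
      have e := ih (by omega)
      exact eq_of_isDyck_of_true (H.bulge_of_lt h1 hi) (e ▸ H'.bulge_of_lt h1 hi)
        (H.ones i h1 hi.le) (H'.ones i h1 hi.le)
  · rcases Nat.eq_zero_or_pos i with rfl | h1
    · rw [H.mid, H'.mid, hp]
    induction h2 using Nat.decreasingInduction with
    | self => rw [H.last, H'.last]
    | of_succ i hi ih =>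
      have e := ih (by omega)
      exact eq_of_isDyck_of_true (H.dent_of_lt hi) (e ▸ H'.dent_of_lt hi)
        (by simp [compl, H.zeros i h1 hi.le]) (by simp [compl, H'.zeros i h1 hi.le])

/-! ### Counting the gliders of a hill -/

lemma GliderIn.support {w : ℤ → Bool} {a b : ℤ} {A B : Finset ℤ} (h : GliderIn w a b A B) :
    A.Nonempty ∧ A ⊆ Finset.Ioc a b ∧ B ⊆ Finset.Ioc a b := by
  have mono : ∀ {a b a' b' : ℤ}, a ≤ a' → b' ≤ b → Finset.Ioc a' b' ⊆ Finset.Ioc a b :=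
    fun h1 h2 => Finset.Ioc_subset_Ioc h1 h2
  induction h with
  | factor h1 h2 h3 _ ih =>
    exact ⟨ih.1, ih.2.1.trans (mono h1.1 h3.1), ih.2.2.trans (mono h1.1 h3.1)⟩
  | @own w a b h c d H =>
    have h0 := H.pos
    refine ⟨⟨c 1, Finset.mem_image_of_mem _ (by simp [h0])⟩, ?_, ?_⟩ <;>
    · intro s hs
      simp only [Finset.mem_image, Finset.mem_Icc, Finset.mem_Ioc] at hs ⊢
      obtain ⟨i, hi, rfl⟩ := hs
      have h1 := H.mono_ones le_rfl hi.1 hi.2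
      have h2 := H.mono_ones hi.1 hi.2 le_rfl
      have h3 := H.mono_zeros (Nat.zero_le i) hi.2
      have h4 := H.mono_zeros hi.2 le_rfl
      have h5 := H.mono_ones le_rfl h0 le_rfl
      have h6 := H.mono_zeros (Nat.zero_le h) le_rfl
      have h7 := H.first
      have h8 := H.mid
      have h9 := H.last
      omega
  | @bulge w a b h c d A B i H hi hi' _ ih =>
    have h1 := H.mono_ones le_rfl hi (by omega)
    have h2 := H.mono_ones (i := i + 1) (by omega) (by omega) le_rfl
    have h6 := H.mono_zeros (Nat.zero_le h) le_rfl
    have h7 := H.first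
    have h8 := H.mid
    have h9 := H.last
    exact ⟨ih.1, ih.2.1.trans (mono (by omega) (by omega)),
      ih.2.2.trans (mono (by omega) (by omega))⟩
  | @dent w a b h c d A B i H hi _ ih =>
    have h1 := H.mono_ones le_rfl H.pos le_rfl
    have h3 := H.mono_zeros (Nat.zero_le i) (by omega)
    have h4 := H.mono_zeros (i := i + 1) (by omega) le_rfl
    have h7 := H.first
    have h8 := H.mid
    have h9 := H.last
    exact ⟨ih.1, ih.2.1.trans (mono (by omega) (by omega)),
      ih.2.2.trans (mono (by omega) (by omega))⟩

lemma GliderIn.lt {w : ℤ → Bool} {a b : ℤ} {A B : Finset ℤ} (h : GliderIn w a b A B) :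
    a < b := by
  obtain ⟨⟨s, hs⟩, h1, -⟩ := h.support
  have := Finset.mem_Ioc.1 (h1 hs)
  omega

lemma IsPrimeDyck.le_of_isDyck {w : ℤ → Bool} {a m b : ℤ} (h : IsPrimeDyck w a m)
    (h' : IsDyck w a b) (hab : a < b) : m ≤ b := by
  rw [isPrimeDyck_iff] at h
  rw [isDyck_iff] at h'
  by_contra hc
  have := h.2.2 b hab (by omega)
  omega

lemma IsPrimeDyck.unique {w : ℤ → Bool} {a m b : ℤ} (h : IsPrimeDyck w a m)
    (h' : IsPrimeDyck w a b) : m = b :=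
  le_antisymm (h.le_of_isDyck h'.isDyck h'.1) (h'.le_of_isDyck h.isDyck h.1)

lemma IsDyck.of_prefix {w : ℤ → Bool} {a m b : ℤ} (h : IsDyck w a b)
    (hm : height w m = height w a) (ham : a ≤ m) (hmb : m ≤ b) : IsDyck w m b := by
  rw [isDyck_iff] at h ⊢
  exact ⟨hmb, by omega, fun q h1 h2 => by have := h.2.2 q (by omega) h2; omega⟩

lemma IsDyck.trans {w : ℤ → Bool} {a m b : ℤ} (h : IsDyck w a m) (h' : IsDyck w m b) :
    IsDyck w a b := by
  rw [isDyck_iff] at h h' ⊢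
  refine ⟨by omega, by omega, fun q h1 h2 => ?_⟩
  rcases le_total q m with hq | hq
  · exact h.2.2 q h1 hq
  · have := h'.2.2 q hq h2; omega

/-- The gliders of a Dyck word are those of its first prime factor and those of the rest. -/
lemma gliderIn_iff_of_isPrimeDyck {w : ℤ → Bool} {a m b : ℤ} {A B : Finset ℤ}
    (hm : IsPrimeDyck w a m) (hb : IsDyck w m b) :
    GliderIn w a b A B ↔ GliderIn w a m A B ∨ GliderIn w m b A B := by
  constructor
  · intro h
    have prime : IsPrimeDyck w a b → GliderIn w a m A B ∨ GliderIn w m b A B := fun hp => by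
      rw [hm.unique hp]; exact .inl h
    cases h with
    | @factor _ _ a' b' _ _ _ h1 h2 h3 h4 =>
      rcases h1.1.eq_or_lt with rfl | hlt
      · rw [hm.unique h2]; exact .inl h4
      · have hle := hm.le_of_isDyck h1 hlt
        exact .inr (.factor (h1.of_prefix (isPrimeDyck_iff.1 hm).2.1 hm.1.le hle) h2 h3 h4)
    | own H => exact prime H.prime
    | bulge _ H => exact prime H.prime
    | dent _ H => exact prime H.prime
  · rintro (h | h)
    · exact .factor (isDyck_self w a) hm hb h
    · have hlt := h.lt
      cases h with
      | @factor _ _ a' b' _ _ _ h1 h2 h3 h4 => exact .factor (hm.isDyck.trans h1) h2 h3 h4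
      | own H => exact .factor hm.isDyck H.prime (isDyck_self w b) (.own H)
      | bulge i H h1 h2 h3 =>
        exact .factor hm.isDyck H.prime (isDyck_self w b) (.bulge i H h1 h2 h3)
      | dent i H h1 h2 => exact .factor hm.isDyck H.prime (isDyck_self w b) (.dent i H h1 h2)

/-- The gliders of a hill with a given decomposition. -/
lemma HillDecomposition.gliderIn_iff {w : ℤ → Bool} {a b : ℤ} {h : ℕ} {c d : ℕ → ℤ}
    (H : HillDecomposition w a b h c d) {A B : Finset ℤ} :
    GliderIn w a b A B ↔
      (A = (Finset.Icc 1 h).image c ∧ B = (Finset.Icc 1 h).image d) ∨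
      (∃ i ∈ Finset.Ico 1 h, GliderIn w (c i) (c (i + 1) - 1) A B) ∨
      ∃ i ∈ Finset.range h, GliderIn (compl w) (d i) (d (i + 1) - 1) A B := by
  constructor
  · intro hG
    induction hG generalizing h c d with
    | @factor w a a' b' b A B h1 h2 h3 _ ih =>
      rcases h1.1.eq_or_lt with rfl | hlt
      · obtain rfl := H.prime.unique h2
        exact ih H
      · have := H.prime.le_of_isDyck h1 hlt
        have := h2.1
        have := h3.1
        omega
    | @own w a b h' c' d' H' =>
      obtain ⟨rfl, hc, hd⟩ := H.unique H'
      refine .inl ⟨Finset.image_congr fun i hi => ?_, Finset.image_congr fun i hi => ?_⟩ <;>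
        simp only [Finset.coe_Icc, Set.mem_Icc] at hi
      · exact (hc i hi.1 hi.2).symm
      · exact (hd i hi.2).symm
    | @bulge w a b h' c' d' A B i H' hi hi' hG _ =>
      obtain ⟨rfl, hc, hd⟩ := H.unique H'
      rw [← hc i hi (by omega), ← hc (i + 1) (by omega) (by omega)] at hG
      exact .inr (.inl ⟨i, by simp; omega, hG⟩)
    | @dent w a b h' c' d' A B i H' hi hG _ =>
      obtain ⟨rfl, hc, hd⟩ := H.unique H'
      rw [← hd i (by omega), ← hd (i + 1) (by omega)] at hG
      exact .inr (.inr ⟨i, by simp; omega, hG⟩)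
  · rintro (⟨rfl, rfl⟩ | ⟨i, hi, hG⟩ | ⟨i, hi, hG⟩)
    · exact .own H
    · simp only [Finset.mem_Ico] at hi
      -- The index `i = h - 1` belongs to an empty word, which has no gliders; the dents below are
      -- treated likewise.
      refine .bulge i H hi.1 ?_ hG
      by_contra hc
      have h1 := H.final_one i hi.1 (by omega)
      have h2 := hG.lt
      omega
    · simp only [Finset.mem_range] at hi
      refine .dent i H ?_ hG
      by_contra hc
      have h1 := H.final_zero i (by omega)
      have h2 := hG.lt
      omega

open Classical in
/-- The finite set of gliders of the hill between the points `a` and `b`. -/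
noncomputable def hillGliders (w : ℤ → Bool) (a b : ℤ) : Finset (Finset ℤ × Finset ℤ) :=
  ((Finset.Ioc a b).powerset ×ˢ (Finset.Ioc a b).powerset).filter
    fun γ => GliderIn w a b γ.1 γ.2

lemma mem_hillGliders {w : ℤ → Bool} {a b : ℤ} {γ : Finset ℤ × Finset ℤ} :
    γ ∈ hillGliders w a b ↔ GliderIn w a b γ.1 γ.2 := by
  simp only [hillGliders, Finset.mem_filter, Finset.mem_product, Finset.mem_powerset,
    and_iff_right_iff_imp]
  exact fun h => h.support.2

/-- Only positions matter: the set of 1s of a glider is nonempty and lies inside the interval. Hence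
bulges can be compared with complemented dents. -/
lemma disjoint_hillGliders {w w' : ℤ → Bool} {a b a' b' : ℤ} (h : b ≤ a') :
    Disjoint (hillGliders w a b) (hillGliders w' a' b') := by
  rw [Finset.disjoint_left]
  intro γ h1 h2
  obtain ⟨⟨s, hs⟩, h3, -⟩ := (mem_hillGliders.1 h1).support
  have h4 := Finset.mem_Ioc.1 (h3 hs)
  have h5 := Finset.mem_Ioc.1 ((mem_hillGliders.1 h2).support.2.1 hs)
  omega

/-- Potential function that counts the descents `10`. -/
noncomputable def descentSum (w : ℤ → Bool) (p : ℤ) : ℤ :=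
  signedSum (fun i => if w i = true ∧ w (i + 1) = false then 1 else 0) 0 p

lemma descentSum_succ (w : ℤ → Bool) (p : ℤ) : descentSum w (p + 1) =
    descentSum w p + if w (p + 1) = true ∧ w (p + 1 + 1) = false then 1 else 0 :=
  signedSum_succ _ _ _

lemma descentSum_eq (w : ℤ → Bool) (p : ℤ) : descentSum w p =
    descentSum w (p - 1) + if w p = true ∧ w (p + 1) = false then 1 else 0 := by
  simpa using descentSum_succ w (p - 1)

/-- Descents and ascents alternate. -/
lemma descentSum_compl_sub (w : ℤ → Bool) {a b : ℤ} (h : w (a + 1) = w (b + 1)) :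
    descentSum (compl w) b - descentSum (compl w) a = descentSum w b - descentSum w a := by
  -- Ascents minus descents telescope to the bit following the point `p`.
  have key : ∀ p, descentSum (compl w) p = descentSum w p +
      ((if w (p + 1) = true then 1 else 0) - if w 1 = true then 1 else 0) := by
    intro p
    have := signedSum_eq_sub (g := fun i => if compl w i = true ∧ compl w (i + 1) = false
      then 1 else 0) (H := fun p => descentSum w p + if w (p + 1) = true then 1 else 0)
      (fun p => by
        simp only [descentSum_succ, compl]
        rcases Bool.eq_false_or_eq_true (w (p + 1)) with h | h <;>
        rcases Bool.eq_false_or_eq_true (w (p + 1 + 1)) with h' | h' <;> simp [h, h']) 0 p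
    rw [descentSum, this]
    simp [descentSum, signedSum]
    ring
  rw [key, key, h]
  ring

lemma HillDecomposition.next_of_lt {w : ℤ → Bool} {a b : ℤ} {h : ℕ} {c d : ℕ → ℤ}
    (H : HillDecomposition w a b h c d) {i : ℕ} (hi : 1 ≤ i) (hih : i < h) :
    w (c i + 1) = true := by
  have h1 := H.bulge_of_lt hi hih
  rcases h1.1.eq_or_lt with h2 | h2
  · rw [h2, sub_add_cancel]; exact H.ones _ (by omega) hih
  · exact h1.first h2

lemma HillDecomposition.next_zero_of_lt {w : ℤ → Bool} {a b : ℤ} {h : ℕ} {c d : ℕ → ℤ}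
    (H : HillDecomposition w a b h c d) {i : ℕ} (hih : i < h) :
    w (d i + 1) = false := by
  have h1 := H.dent_of_lt hih
  rcases h1.1.eq_or_lt with h2 | h2
  · rw [h2, sub_add_cancel]; exact H.zeros _ (by omega) hih
  · simpa [compl] using h1.first h2

/-- The descents of a hill are its peak, the descents of its bulges, and those of its
complemented dents. -/
lemma HillDecomposition.descentSum_sub {w : ℤ → Bool} {a b : ℤ} {h : ℕ} {c d : ℕ → ℤ}
    (H : HillDecomposition w a b h c d) :
    descentSum w b - descentSum w a = 1 +
      ((∑ i ∈ Finset.Ico 1 h, (descentSum w (c (i + 1) - 1) - descentSum w (c i))) +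
      ∑ i ∈ Finset.range h,
        (descentSum (compl w) (d (i + 1) - 1) - descentSum (compl w) (d i))) := by
  have h0 := H.pos
  have e1 : ∑ i ∈ Finset.Ico 1 h, (descentSum w (c (i + 1) - 1) - descentSum w (c i)) =
      descentSum w (c h - 1) - descentSum w a := by
    -- Each displayed 1 before the peak is followed by a 1, so including it adds no descent and the
    -- sum telescopes.
    have hs : ∀ i ∈ Finset.Ico 1 h, descentSum w (c (i + 1) - 1) - descentSum w (c i) =
        descentSum w (c (i + 1) - 1) - descentSum w (c i - 1) := by
      intro i hi
      rw [Finset.mem_Ico] at hi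
      rw [descentSum_eq w (c i), H.next_of_lt hi.1 hi.2]
      simp
    rw [Finset.sum_congr rfl hs, Finset.sum_Ico_sub (fun i => descentSum w (c i - 1)) h0, H.first]
    simp
  have e2 : ∑ i ∈ Finset.range h,
      (descentSum (compl w) (d (i + 1) - 1) - descentSum (compl w) (d i)) =
      descentSum w b - descentSum w (c h) := by
    have hs : ∀ i ∈ Finset.range h,
        descentSum (compl w) (d (i + 1) - 1) - descentSum (compl w) (d i) =
        descentSum w (d (i + 1)) - descentSum w (d i) := by
      intro i hi
      rw [Finset.mem_range] at hi
      have h1 := H.zeros (i + 1) (by omega) hi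
      rw [descentSum_compl_sub, descentSum_eq w (d (i + 1)), h1]
      · simp
      · rw [sub_add_cancel, h1, H.next_zero_of_lt hi]
    rw [Finset.sum_congr rfl hs, Finset.sum_range_sub (fun i => descentSum w (d i)), H.last, H.mid]
  have e3 : descentSum w (c h) = descentSum w (c h - 1) + 1 := by
    have h1 := H.next_zero_of_lt (i := 0) h0
    rw [H.mid] at h1
    rw [descentSum_eq w (c h), if_pos ⟨H.ones h h0 le_rfl, h1⟩]
  rw [e1, e2, e3]
  ring

-- The own glider contains `c 1`, which lies in no bulge or dent, and these occupy disjoint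
-- intervals; so the union in `gliderIn_iff` is disjoint.
open Classical in
lemma HillDecomposition.card_hillGliders {w : ℤ → Bool} {a b : ℤ} {h : ℕ} {c d : ℕ → ℤ}
    (H : HillDecomposition w a b h c d) :
    (hillGliders w a b).card = 1 +
      ((∑ i ∈ Finset.Ico 1 h, (hillGliders w (c i) (c (i + 1) - 1)).card) +
      ∑ i ∈ Finset.range h, (hillGliders (compl w) (d i) (d (i + 1) - 1)).card) := by
  have h0 := H.pos
  have hU : hillGliders w a b = {((Finset.Icc 1 h).image c, (Finset.Icc 1 h).image d)} ∪
      ((Finset.Ico 1 h).biUnion (fun i => hillGliders w (c i) (c (i + 1) - 1)) ∪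
      (Finset.range h).biUnion fun i => hillGliders (compl w) (d i) (d (i + 1) - 1)) := by
    ext γ
    simp only [Finset.mem_union, Finset.mem_biUnion, mem_hillGliders, Finset.mem_singleton,
      H.gliderIn_iff, Prod.ext_iff]
  rw [hU, Finset.card_union_of_disjoint, Finset.card_union_of_disjoint, Finset.card_biUnion,
    Finset.card_biUnion, Finset.card_singleton]
  · have key : ∀ i < h, ∀ j < h, i < j → Disjoint (hillGliders (compl w) (d i) (d (i + 1) - 1))
        (hillGliders (compl w) (d j) (d (j + 1) - 1)) := fun i hi j hj hij => by
      have := H.mono_zeros (i := i + 1) (j := j) hij hj.le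
      exact disjoint_hillGliders (by omega)
    intro i hi j hj hij
    rw [Finset.mem_coe, Finset.mem_range] at hi hj
    rcases hij.lt_or_gt with h1 | h1
    · exact key i hi j hj h1
    · exact (key j hj i hi h1).symm
  · have key : ∀ i < h, ∀ j < h, i < j → Disjoint (hillGliders w (c i) (c (i + 1) - 1))
        (hillGliders w (c j) (c (j + 1) - 1)) := fun i hi j hj hij => by
      have := H.mono_ones (i := i + 1) (j := j) (by omega) hij hj.le
      exact disjoint_hillGliders (by omega)
    intro i hi j hj hij
    rw [Finset.mem_coe, Finset.mem_Ico] at hi hj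
    rcases hij.lt_or_gt with h1 | h1
    · exact key i hi.2 j hj.2 h1
    · exact (key j hj.2 i hi.2 h1).symm
  · simp only [Finset.disjoint_biUnion_left, Finset.disjoint_biUnion_right]
    intro i hi j hj
    rw [Finset.mem_range] at hi
    rw [Finset.mem_Ico] at hj
    refine disjoint_hillGliders ?_
    have h1 := H.mono_ones (i := j + 1) (j := h) (by omega) (by omega) le_rfl
    have h2 := H.mono_zeros (Nat.zero_le i) hi.le
    have h3 := H.mid
    omega
  · have hmem : c 1 ∈ (Finset.Icc 1 h).image c := Finset.mem_image_of_mem _ (by simp [h0])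
    have hout : ∀ {w' : ℤ → Bool} {a' b' : ℤ}, c 1 ≤ a' →
        ((Finset.Icc 1 h).image c, (Finset.Icc 1 h).image d) ∉ hillGliders w' a' b' := by
      intro w' a' b' ha hγ
      have := Finset.mem_Ioc.1 ((mem_hillGliders.1 hγ).support.2.1 hmem)
      omega
    simp only [Finset.disjoint_singleton_left, Finset.mem_union, Finset.mem_biUnion, not_or,
      not_exists, not_and]
    refine ⟨fun i hi => hout ?_, fun i hi => hout ?_⟩
    · rw [Finset.mem_Ico] at hi
      have := H.mono_ones le_rfl hi.1 hi.2.le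
      omega
    · rw [Finset.mem_range] at hi
      have h1 := H.mono_ones le_rfl h0 le_rfl
      have h2 := H.mono_zeros (Nat.zero_le i) hi.le
      have h3 := H.mid
      omega

open Classical in
lemma card_hillGliders_of_isPrimeDyck {w : ℤ → Bool} {a m b : ℤ} (hm : IsPrimeDyck w a m)
    (hb : IsDyck w m b) :
    (hillGliders w a b).card = (hillGliders w a m).card + (hillGliders w m b).card := by
  rw [← Finset.card_union_of_disjoint (disjoint_hillGliders le_rfl)]
  congr 1
  ext γ
  simp only [Finset.mem_union, mem_hillGliders, gliderIn_iff_of_isPrimeDyck hm hb]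

/-- A Dyck word has as many gliders as descents. -/
lemma card_hillGliders {w : ℤ → Bool} {a b : ℤ} (hD : IsDyck w a b) :
    ((hillGliders w a b).card : ℤ) = descentSum w b - descentSum w a := by
  induction hl : (b - a).toNat using Nat.strong_induction_on generalizing w a b with
  | _ l ih =>
    rcases hD.1.eq_or_lt with rfl | hab
    · have : hillGliders w a a = ∅ := by
        ext γ
        simpa [mem_hillGliders] using fun h => (GliderIn.lt h).false
      simp [this]
    obtain ⟨m, hmb, hm⟩ := exists_isPrimeDyck (hD.first hab) hab (isDyck_iff.1 hD).2.1.le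
    have hmb' := hD.of_prefix (isPrimeDyck_iff.1 hm).2.1 hm.1.le hmb
    have ham := hm.1
    rcases hmb.eq_or_lt with rfl | hlt
    · obtain ⟨h, c, d, H⟩ := exists_hillDecomposition hm
      have h0 := H.pos
      have h7 := H.first
      have h8 := H.mid
      have h9 := H.last
      rw [H.card_hillGliders, H.descentSum_sub]
      push_cast
      congr 2
      · refine Finset.sum_congr rfl fun i hi => ?_
        rw [Finset.mem_Ico] at hi
        have h1 := H.mono_ones le_rfl hi.1 hi.2.le
        have h2 := H.mono_ones (i := i + 1) (by omega) hi.2 le_rfl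
        have h3 := H.mono_zeros (Nat.zero_le h) le_rfl
        exact ih _ (by omega) (H.bulge_of_lt hi.1 hi.2) rfl
      · refine Finset.sum_congr rfl fun i hi => ?_
        rw [Finset.mem_range] at hi
        have h1 := H.mono_ones le_rfl h0 le_rfl
        have h2 := H.mono_zeros (Nat.zero_le i) hi.le
        have h3 := H.mono_zeros (i := i + 1) hi le_rfl
        exact ih _ (by omega) (H.dent_of_lt hi) rfl
    · rw [card_hillGliders_of_isPrimeDyck hm hmb']
      push_cast
      rw [ih _ (by omega) hm.isDyck rfl, ih _ (by omega) hmb' rfl]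
      ring

/-! ### Points on the ground, records and matched bits -/

/-- The path is at its lowest level so far. -/
def Ground (w : ℤ → Bool) (p : ℤ) : Prop := ∀ q ≤ p, height w p ≤ height w q

/-- The path reaches a new lowest level with step `i`. -/
def IsRecord (w : ℤ → Bool) (i : ℤ) : Prop := ∀ q < i, height w i < height w q

lemma IsRecord.bit {w : ℤ → Bool} {i : ℤ} (h : IsRecord w i) : w i = false := by
  have h1 := h (i - 1) (by omega)
  rcases step_cases w i with h2 | h2
  · omega
  · exact h2.1

lemma IsRecord.ground_pred {w : ℤ → Bool} {i : ℤ} (h : IsRecord w i) : Ground w (i - 1) := by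
  intro q hq
  have h1 := h q (by omega)
  have h2 := height_of_false h.bit
  omega

lemma Ground.isRecord {w : ℤ → Bool} {p : ℤ} (h : Ground w p) (hw : w (p + 1) = false) :
    IsRecord w (p + 1) := by
  intro q hq
  have h1 := h q (by omega)
  have h2 := height_of_false hw
  simp only [add_sub_cancel_right] at h2
  omega

lemma IsRecord.ground {w : ℤ → Bool} {i : ℤ} (h : IsRecord w i) : Ground w i := by
  intro q hq
  rcases hq.eq_or_lt with rfl | hq
  · exact le_rfl
  · exact (h q hq).le

lemma Ground.of_isDyck {w : ℤ → Bool} {a b : ℤ} (h : Ground w a) (hD : IsDyck w a b) :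
    Ground w b := by
  rw [isDyck_iff] at hD
  intro q hq
  rcases le_total q a with h1 | h1
  · have := h q h1; omega
  · have := hD.2.2 q h1 hq; omega

lemma height_add_mul_le {w : ℤ → Bool} {n : ℕ} (hW : ∀ p, height w (p + n) < height w p)
    (p : ℤ) (t : ℕ) : height w (p + t * n) ≤ height w p - t := by
  induction t with
  | zero => simp
  | succ t ih =>
    have := hW (p + t * n)
    have e : p + ((t + 1 : ℕ) : ℤ) * n = p + t * n + n := by push_cast; ring
    rw [e]
    push_cast
    omega

lemma exists_height_lt {w : ℤ → Bool} {n : ℕ} (hW : ∀ p, height w (p + n) < height w p)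
    (p v : ℤ) : ∃ q, p < q ∧ height w q < v := by
  have hn : n ≠ 0 := by rintro rfl; simpa using hW 0
  refine ⟨p + ((height w p - v).toNat + 1 : ℕ) * n, ?_, ?_⟩
  · have : (0 : ℤ) < ((height w p - v).toNat + 1 : ℕ) * n := by positivity
    omega
  · have := height_add_mul_le hW p ((height w p - v).toNat + 1)
    omega

lemma exists_min_height {w : ℤ → Bool} {n : ℕ} (hW : ∀ p, height w (p + n) < height w p)
    (p : ℤ) : ∃ m ≤ p, ∀ q ≤ p, height w m ≤ height w q := by
  have hn : n ≠ 0 := by rintro rfl; simpa using hW 0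
  obtain ⟨m, hm, hmin⟩ := Finset.exists_min_image (Finset.Icc (p - n) p) (height w)
    ⟨p, by simp⟩
  simp only [Finset.mem_Icc] at hm hmin
  refine ⟨m, hm.2, fun q hq => ?_⟩
  -- Moving left by a period only raises the path, so the minimum over the last period is the
  -- minimum over the whole past.
  induction hl : (p - q).toNat using Nat.strong_induction_on generalizing q with
  | _ l ih =>
    by_cases h : p - n ≤ q
    · exact hmin q ⟨h, hq⟩
    · have h1 := ih _ (by omega) (q + n) (by omega) rfl
      have h2 := hW q
      omega

/-- The unmatched bits are the steps to a new lowest level. -/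
lemma mem_matched_iff {w : ℤ → Bool} {n : ℕ} (hW : ∀ p, height w (p + n) < height w p) {i : ℤ} :
    i ∈ matched w ↔ ¬ IsRecord w i := by
  have pair : ∀ {a b : ℤ}, IsPrimeDyck w a b → MatchedPair w (a + 1) b := fun {a b} h => by
    have hf := h.isDyck.first h.1
    have hf' := height_of_true hf
    have h' := isPrimeDyck_iff.1 h
    simp only [add_sub_cancel_right] at hf'
    have hne : a + 1 ≠ b := by rintro rfl; omega
    refine ⟨hf, by omega, by simpa using h.2.1, fun j h1 h2 => ?_⟩
    rw [add_sub_cancel_right]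
    exact (h.2.2 j (by omega) h2).ne'
  constructor
  · rintro ⟨j, h | h⟩ hr
    · have h1 := hr.bit
      rw [h.1] at h1
      cases h1
    · have h1 := hr (j - 1) (by have := h.2.1; omega)
      have h2 := h.2.2.1
      rw [balance_eq w (by have := h.2.1; omega)] at h2
      omega
  · intro hr
    rcases step_cases w i with ⟨h1, h2⟩ | ⟨h1, h2⟩
    -- The downward drift makes the path return, so every 1 is matched.
    · obtain ⟨q, hq, hq'⟩ := exists_height_lt hW (i - 1) (height w (i - 1))
      obtain ⟨m, -, hm⟩ := exists_isPrimeDyck (a := i - 1) (by simpa using h1) hq hq'.le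
      exact ⟨m, .inl (by simpa using pair hm)⟩
    · simp only [IsRecord, not_forall, not_lt] at hr
      obtain ⟨q, hq, hq'⟩ := hr
      -- For a 0 that is not a record, the last earlier point that is not higher starts the prime
      -- Dyck word ending at `i`.
      obtain ⟨m, ⟨hm1, hm2⟩, hm3⟩ := Int.exists_greatest_of_bdd
        (P := fun m => m < i ∧ height w m ≤ height w i) ⟨i, fun z hz => hz.1.le⟩ ⟨q, hq, hq'⟩
      have h3 : m ≠ i - 1 := by rintro rfl; omega
      have h4 : ∀ q, m < q → q < i → height w i < height w q := fun q h4 h5 => by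
        by_contra hc
        have := hm3 q ⟨h5, by omega⟩
        omega
      have h5 := h4 (m + 1) (by omega) (by omega)
      have h6 : height w i = height w m := by
        rcases step_cases w (m + 1) with h7 | h7 <;> simp only [add_sub_cancel_right] at h7 <;>
          omega
      exact ⟨m + 1, .inr (pair (isPrimeDyck_iff.2 ⟨hm1, h6, fun q h7 h8 => by
        rw [← h6]; exact h4 q h7 h8⟩))⟩

/-- Height of the path above its lowest level so far, which is the Motzkin path. -/
lemma exists_reduced_height {w : ℤ → Bool} {n : ℕ} (hW : ∀ p, height w (p + n) < height w p) :
    ∃ H : ℤ → ℤ, (∀ p, H (p + 1) = H p + motzkinStep w (p + 1)) ∧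
      ∀ p, H p = 0 ↔ Ground w p := by
  choose m hm hmin using exists_min_height hW
  -- At a record the path and its running minimum both drop by one; at any other step the minimum
  -- stays.
  refine ⟨fun p => height w p - height w (m p), fun p => ?_, fun p => ⟨fun h q hq => ?_,
    fun h => ?_⟩⟩
  · have e1 := hm (p + 1)
    have e2 := hmin (p + 1) (m p) (by have := hm p; omega)
    have e3 := hmin (p + 1) (p + 1) le_rfl
    have e4 := hmin p p le_rfl
    beta_reduce
    unfold motzkinStep
    by_cases hr : IsRecord w (p + 1)
    · have e5 := hr.ground_pred (m p) (by have := hm p; omega)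
      have e6 := hr.ground (m (p + 1)) e1
      have e7 := height_of_false hr.bit
      rw [add_sub_cancel_right] at e5 e7
      rw [if_neg (by rw [mem_matched_iff hW]; exact not_not.2 hr)]
      omega
    · have e6 : height w (m p) ≤ height w (m (p + 1)) := by
        rcases e1.eq_or_lt with h | h
        · simp only [IsRecord, not_forall, not_lt] at hr
          obtain ⟨q, hq, hq'⟩ := hr
          have := hmin p q (by omega)
          rw [h]
          omega
        · exact hmin p _ (by omega)
      rw [if_pos ((mem_matched_iff hW).2 hr), height_succ]
      omega
  · have := hmin p q hq
    beta_reduce at h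
    omega
  · have h1 := hmin p p le_rfl
    have h2 := h (m p) (hm p)
    beta_reduce
    omega

lemma exists_record_after {w : ℤ → Bool} {n : ℕ} (hW : ∀ p, height w (p + n) < height w p)
    (p : ℤ) : ∃ i > p, IsRecord w i := by
  obtain ⟨m, hm, hmin⟩ := exists_min_height hW p
  obtain ⟨q, hq⟩ := exists_height_lt hW p (height w m)
  obtain ⟨i, hi, hi'⟩ := Int.exists_least_of_bdd
    (P := fun i => p < i ∧ height w i < height w m) ⟨p, fun z hz => hz.1.le⟩ ⟨q, hq⟩
  refine ⟨i, hi.1, fun q hq => ?_⟩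
  rcases le_or_gt q p with h | h
  · have := hmin q h; omega
  · by_contra hc
    have := hi' q ⟨h, by omega⟩
    omega

/-! ### Counting the gliders between two points on the ground -/

open Classical in
/-- The gliders of the Dyck subpaths on the ground between the points `p` and `q`. -/
noncomputable def groundGliders (w : ℤ → Bool) (p q : ℤ) : Finset (Finset ℤ × Finset ℤ) :=
  ((Finset.Ioc p q).powerset ×ˢ (Finset.Ioc p q).powerset).filter
    fun γ => ∃ a b, p ≤ a ∧ b ≤ q ∧ Ground w a ∧ IsDyck w a b ∧ GliderIn w a b γ.1 γ.2

lemma mem_groundGliders {w : ℤ → Bool} {p q : ℤ} {γ : Finset ℤ × Finset ℤ} :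
    γ ∈ groundGliders w p q ↔
      ∃ a b, p ≤ a ∧ b ≤ q ∧ Ground w a ∧ IsDyck w a b ∧ GliderIn w a b γ.1 γ.2 := by
  simp only [groundGliders, Finset.mem_filter, Finset.mem_product, Finset.mem_powerset,
    and_iff_right_iff_imp]
  rintro ⟨a, b, h1, h2, -, -, h⟩
  have := Finset.Ioc_subset_Ioc h1 h2
  exact ⟨h.support.2.1.trans this, h.support.2.2.trans this⟩

-- The window is consumed from the left: a 0 on the ground is a record and starts no hill, while a 1
-- starts a prime hill that returns before `q`, since `q` is no higher than `p`.
open Classical in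
theorem card_groundGliders {w : ℤ → Bool} {p q : ℤ} (hpq : p ≤ q) (hp : Ground w p)
    (hq : Ground w q) :
    ((groundGliders w p q).card : ℤ) = descentSum w q - descentSum w p := by
  induction hl : (q - p).toNat using Nat.strong_induction_on generalizing p with
  | _ l ih =>
    rcases hpq.eq_or_lt with rfl | hlt
    · have : groundGliders w p p = ∅ := by
        ext γ
        simp only [mem_groundGliders, Finset.notMem_empty, iff_false]
        rintro ⟨a, b, h1, h2, -, -, h⟩
        have := h.lt
        omega
      simp [this]
    cases hw : w (p + 1)
    · have hg := (hp.isRecord hw).ground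
      have : groundGliders w p q = groundGliders w (p + 1) q := by
        ext γ
        simp only [mem_groundGliders]
        constructor
        · rintro ⟨a, b, h1, h2, h3, h4, h5⟩
          refine ⟨a, b, ?_, h2, h3, h4, h5⟩
          have h6 : p ≠ a := by
            rintro rfl
            rw [h4.first h5.lt] at hw
            cases hw
          omega
        · rintro ⟨a, b, h1, h⟩
          exact ⟨a, b, by omega, h⟩
      rw [this, ih _ (by omega) (by omega) hg rfl, descentSum_succ, hw]
      simp
    · obtain ⟨m, hmq, hm⟩ := exists_isPrimeDyck hw hlt (hq p hlt.le)
      have hpm := hm.1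
      have hgm := hp.of_isDyck hm.isDyck
      have hm' := isPrimeDyck_iff.1 hm
      have : groundGliders w p q = hillGliders w p m ∪ groundGliders w m q := by
        ext γ
        simp only [mem_groundGliders, Finset.mem_union, mem_hillGliders]
        constructor
        · rintro ⟨a, b, h1, h2, h3, h4, h5⟩
          rcases le_or_gt m a with h6 | h6
          · exact .inr ⟨a, b, h6, h2, h3, h4, h5⟩
          -- A prime hill has no ground points in its interior.
          · obtain rfl : p = a := by
              by_contra hne
              have h7 := hm'.2.2 a (by omega) h6
              have h8 := h3 p h1
              omega
            have h7 := h4.of_prefix hm'.2.1 hpm.le (hm.le_of_isDyck h4 h5.lt)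
            rcases (gliderIn_iff_of_isPrimeDyck hm h7).1 h5 with h8 | h8
            · exact .inl h8
            · exact .inr ⟨m, b, le_rfl, h2, hgm, h7, h8⟩
        · rintro (h | ⟨a, b, h1, h⟩)
          · exact ⟨p, m, le_rfl, hmq, hp, hm.isDyck, h⟩
          · exact ⟨a, b, by omega, h⟩
      have hdisj : Disjoint (hillGliders w p m) (groundGliders w m q) := by
        rw [Finset.disjoint_left]
        intro γ h1 h2
        obtain ⟨a, b, h3, -, -, -, h4⟩ := mem_groundGliders.1 h2
        exact Finset.disjoint_left.1 (disjoint_hillGliders h3) h1 (mem_hillGliders.2 h4)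
      rw [this, Finset.card_union_of_disjoint hdisj]
      push_cast
      rw [card_hillGliders hm.isDyck, ih _ (by omega) hmq hgm rfl]
      ring

/-! ### Translation invariance -/

/-- The constant appears because heights are normalized to vanish at 0. -/
lemma height_shift (w : ℤ → Bool) (s p : ℤ) :
    height (fun i => w (i - s)) p = height w (p - s) - height w (-s) := by
  have := signedSum_eq_sub (g := fun i => if w (i - s) = true then 1 else -1)
    (H := fun p => height w (p - s)) (fun p => by
      rw [show p + 1 - s = p - s + 1 by ring, height_succ]) 0 p
  rw [height, this, zero_sub]

lemma IsDyck.shift {w : ℤ → Bool} {a b : ℤ} (h : IsDyck w a b) (s : ℤ) :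
    IsDyck (fun i => w (i - s)) (a + s) (b + s) := by
  rw [isDyck_iff] at h ⊢
  simp only [height_shift, add_sub_cancel_right]
  refine ⟨by omega, by omega, fun q h1 h2 => ?_⟩
  have := h.2.2 (q - s) (by omega) (by omega)
  omega

lemma IsPrimeDyck.shift {w : ℤ → Bool} {a b : ℤ} (h : IsPrimeDyck w a b) (s : ℤ) :
    IsPrimeDyck (fun i => w (i - s)) (a + s) (b + s) := by
  rw [isPrimeDyck_iff] at h ⊢
  simp only [height_shift, add_sub_cancel_right]
  refine ⟨by omega, by omega, fun q h1 h2 => ?_⟩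
  have := h.2.2 (q - s) (by omega) (by omega)
  omega

lemma HillDecomposition.shift {w : ℤ → Bool} {a b : ℤ} {h : ℕ} {c d : ℕ → ℤ}
    (H : HillDecomposition w a b h c d) (s : ℤ) :
    HillDecomposition (fun i => w (i - s)) (a + s) (b + s) h (fun i => c i + s)
      (fun i => d i + s) where
  prime := H.prime.shift s
  pos := H.pos
  peak := by
    obtain ⟨h1, h2, h3, h4⟩ := H.peak
    refine ⟨by omega, by omega, fun q h5 h6 => ?_, fun q h5 h6 => ?_⟩
    · have := h3 (q - s) (by omega) (by omega)
      rw [balance_eq _ h1, balance_eq _ (by omega)] at this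
      rw [balance_eq _ (by omega), balance_eq _ (by omega)]
      simp only [height_shift, add_sub_cancel_right]
      omega
    · have := h4 (q - s) (by omega) (by omega)
      rw [balance_eq _ h1, balance_eq _ (by omega)] at this
      rw [balance_eq _ (by omega), balance_eq _ (by omega)]
      simp only [height_shift, add_sub_cancel_right]
      omega
  height := by
    have h1 := H.peak.1
    have h2 := H.height
    rw [balance_eq _ h1] at h2
    rw [balance_eq _ (by omega)]
    simp only [height_shift, add_sub_cancel_right]
    omega
  first := by have := H.first; omega
  mid := by have := H.mid; omega
  last := by have := H.last; omega
  ones i h1 h2 := by simpa using H.ones i h1 h2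
  zeros i h1 h2 := by simpa using H.zeros i h1 h2
  bulge i h1 h2 := by
    have := (H.bulge i h1 h2).shift s
    rwa [sub_add_eq_add_sub] at this
  dent i h2 := by
    have := (H.dent i h2).shift s
    rwa [sub_add_eq_add_sub] at this
  final_one i h1 h2 := by have := H.final_one i h1 h2; omega
  final_zero i h2 := by have := H.final_zero i h2; omega

lemma GliderIn.shift {w : ℤ → Bool} {a b : ℤ} {A B : Finset ℤ} (h : GliderIn w a b A B) (s : ℤ) :
    GliderIn (fun i => w (i - s)) (a + s) (b + s) (A.image (· + s)) (B.image (· + s)) := by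
  induction h with
  | factor h1 h2 h3 _ ih => exact .factor (h1.shift s) (h2.shift s) (h3.shift s) ih
  | own H => rw [Finset.image_image, Finset.image_image]; exact .own (H.shift s)
  | bulge i H h1 h2 _ ih =>
    rw [sub_add_eq_add_sub] at ih
    exact .bulge i (H.shift s) h1 h2 ih
  | dent i H h1 _ ih =>
    rw [sub_add_eq_add_sub] at ih
    exact .dent i (H.shift s) h1 ih

/-! ### Cyclic strings -/

lemma intCast_injOn_Ioc (n : ℕ) (p : ℤ) :
    Set.InjOn (fun i : ℤ => (i : ZMod n)) (Set.Ioc p (p + n)) := by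
  intro i hi j hj h
  simp only [Set.mem_Ioc] at hi hj
  have h2 : (n : ℤ) ∣ j - i := (ZMod.intCast_eq_intCast_iff_dvd_sub i j n).1 h
  have h3 : j - i = 0 := Int.eq_zero_of_abs_lt_dvd h2 (by rw [abs_lt]; omega)
  omega

lemma sum_Ioc_period {n : ℕ} [NeZero n] (g : ZMod n → ℤ) (p : ℤ) :
    ∑ i ∈ Finset.Ioc p (p + n), g (i : ZMod n) = ∑ r, g r := by
  have hn : 0 < n := Nat.pos_of_ne_zero (NeZero.ne n)
  refine Finset.sum_nbij (fun i : ℤ => (i : ZMod n)) (by simp) ?_ ?_ (by simp)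
  · simpa using intCast_injOn_Ioc n p
  · intro r _
    have h := ZMod.val_lt (r - ((p + 1 : ℤ) : ZMod n))
    refine ⟨p + 1 + ((r - ((p + 1 : ℤ) : ZMod n)).val : ℤ), ?_, ?_⟩
    · rw [Finset.mem_coe, Finset.mem_Ioc]; omega
    push_cast
    rw [ZMod.natCast_zmod_val]
    ring

lemma mem_bitstrings_iff {n k : ℕ} [NeZero n] {x : ZMod n → Bool} :
    x ∈ bitstrings n k ↔ (∑ r, if x r = true then (1 : ℤ) else 0) = k := by
  rw [bitstrings, Set.mem_ofPred_eq, Set.ncard_eq_toFinset_card', Finset.sum_boole]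
  simp

lemma height_add_period {n k : ℕ} [NeZero n] {x : ZMod n → Bool} (hx : x ∈ bitstrings n k)
    (p : ℤ) : height (unroll x) (p + n) = height (unroll x) p + (2 * k - n) := by
  have h1 : ∑ i ∈ Finset.Ioc p (p + n), (if x (i : ZMod n) = true then (1 : ℤ) else -1) =
      height (unroll x) (p + n) - height (unroll x) p :=
    sum_Ioc_eq_sub (height_succ (unroll x)) (by omega)
  have h2 := sum_Ioc_period (fun r => if x r = true then (1 : ℤ) else -1) p
  have h3 : (∑ r, if x r = true then (1 : ℤ) else -1) = 2 * k - n := by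
    rw [← mem_bitstrings_iff.1 hx, Finset.mul_sum]
    have h4 : (n : ℤ) = ∑ r : ZMod n, 1 := by simp
    rw [h4, ← Finset.sum_sub_distrib]
    exact Finset.sum_congr rfl fun r _ => by split_ifs <;> norm_num
  rw [h2, h3] at h1
  omega

lemma height_add_period_lt {n k : ℕ} [NeZero n] {x : ZMod n → Bool} (hx : x ∈ bitstrings n k)
    (hn : 2 * k + 1 ≤ n) (p : ℤ) : height (unroll x) (p + n) < height (unroll x) p := by
  rw [height_add_period hx]; omega

lemma descents_eq_sum {n : ℕ} [NeZero n] (x : ZMod n → Bool) :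
    (descents x : ℤ) = ∑ r, if x r = true ∧ x (r + 1) = false then (1 : ℤ) else 0 := by
  rw [descents, Set.ncard_eq_toFinset_card', Finset.sum_boole]
  simp

lemma descents_eq {n : ℕ} [NeZero n] (x : ZMod n → Bool) (p : ℤ) :
    (descents x : ℤ) = descentSum (unroll x) (p + n) - descentSum (unroll x) p := by
  rw [← sum_Ioc_eq_sub (g := fun i => if unroll x i = true ∧ unroll x (i + 1) = false
    then 1 else 0) (descentSum_succ (unroll x)) (by omega), descents_eq_sum, ← sum_Ioc_period _ p]
  simp [unroll]

lemma unroll_shift {n : ℕ} (x : ZMod n → Bool) {s : ℤ} (hs : (n : ℤ) ∣ s) :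
    (fun i => unroll x (i - s)) = unroll x := by
  funext i
  have : ((s : ℤ) : ZMod n) = 0 := (ZMod.intCast_zmod_eq_zero_iff_dvd s n).2 hs
  simp [unroll, this]

lemma Ground.shift {w : ℤ → Bool} {p : ℤ} (h : Ground w p) (s : ℤ) :
    Ground (fun i => w (i - s)) (p + s) := by
  intro q hq
  have := h (q - s) (by omega)
  simp only [height_shift, add_sub_cancel_right]
  omega

lemma IsRecord.shift {w : ℤ → Bool} {p : ℤ} (h : IsRecord w p) (s : ℤ) :
    IsRecord (fun i => w (i - s)) (p + s) := by
  intro q hq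
  have := h (q - s) (by omega)
  simp only [height_shift, add_sub_cancel_right]
  omega

lemma isRecord_congr {n : ℕ} (x : ZMod n → Bool) {i j : ℤ} (h : (i : ZMod n) = j) :
    IsRecord (unroll x) i ↔ IsRecord (unroll x) j := by
  have key : ∀ {i j : ℤ}, (i : ZMod n) = j → IsRecord (unroll x) i → IsRecord (unroll x) j := by
    intro i j h hi
    have h1 := hi.shift (j - i)
    rwa [unroll_shift x ((ZMod.intCast_eq_intCast_iff_dvd_sub i j n).1 h),
      add_sub_cancel] at h1
  exact ⟨key h, key h.symm⟩

lemma isRecord_firstUnmatched {n k : ℕ} [NeZero n] {x : ZMod n → Bool}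
    (hx : x ∈ bitstrings n k) (hn : 2 * k + 1 ≤ n) :
    IsRecord (unroll x) (firstUnmatched x) := by
  have hW := height_add_period_lt hx hn
  obtain ⟨i, hi, hr⟩ := exists_record_after hW 0
  -- Nonemptiness excludes the default value of `sInf` on the empty set.
  have hne : {i : ℕ | 1 ≤ i ∧ (i : ℤ) ∉ matched (unroll x)}.Nonempty := by
    refine ⟨i.toNat, by omega, ?_⟩
    rw [Int.toNat_of_nonneg (by omega), mem_matched_iff hW]
    exact not_not.2 hr
  have := (Nat.sInf_mem hne).2
  rwa [mem_matched_iff hW, not_not] at this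

lemma motzkinHeight_eq_zero_iff {n k : ℕ} [NeZero n] {x : ZMod n → Bool}
    (hx : x ∈ bitstrings n k) (hn : 2 * k + 1 ≤ n) (p : ℤ) :
    motzkinHeight x p = 0 ↔ Ground (unroll x) p := by
  obtain ⟨H, hH, hG⟩ := exists_reduced_height (height_add_period_lt hx hn)
  have h1 := (hG _).2 (isRecord_firstUnmatched hx hn).ground_pred
  have h2 : motzkinHeight x p = H p - H (firstUnmatched x - 1) :=
    signedSum_eq_sub hH _ p
  rw [h2, h1, sub_zero, hG]

lemma isBaseHill_iff {n k : ℕ} [NeZero n] {x : ZMod n → Bool}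
    (hx : x ∈ bitstrings n k) (hn : 2 * k + 1 ≤ n) {a b : ℤ} :
    IsBaseHill x a b ↔ Ground (unroll x) a ∧ IsDyck (unroll x) a b := by
  rw [IsBaseHill, motzkinHeight_eq_zero_iff hx hn, motzkinHeight_eq_zero_iff hx hn]
  exact ⟨fun h => ⟨h.2.1, h.1⟩, fun h => ⟨h.2, h.1, h.1.of_isDyck h.2⟩⟩

lemma residues_injOn {n : ℕ} {p : ℤ} {A B : Finset ℤ} (hA : A ⊆ Finset.Ioc p (p + n))
    (hB : B ⊆ Finset.Ioc p (p + n)) (h : residues n A = residues n B) : A = B := by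
  rw [← Finset.coe_subset, Finset.coe_Ioc] at hA hB
  exact Finset.coe_injective (((intCast_injOn_Ioc n p).image_eq_image_iff hA hB).1 h)

lemma residues_image_add {n : ℕ} (A : Finset ℤ) {s : ℤ} (hs : (n : ℤ) ∣ s) :
    residues n (A.image (· + s)) = residues n A := by
  have : ((s : ℤ) : ZMod n) = 0 := (ZMod.intCast_zmod_eq_zero_iff_dvd s n).2 hs
  rw [residues, Finset.coe_image, Set.image_image]
  simp [residues, this]

/-- Every glider is equivalent to exactly one glider in a window of length `n`. -/
theorem numGliders_eq_card {n k : ℕ} [NeZero n] {x : ZMod n → Bool}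
    (hx : x ∈ bitstrings n k) (hn : 2 * k + 1 ≤ n) {p : ℤ} (hp : IsRecord (unroll x) (p + 1)) :
    numGliders x = (groundGliders (unroll x) p (p + n)).card := by
  have hmem : ∀ γ ∈ groundGliders (unroll x) p (p + n), γ ∈ gliders x := by
    intro γ hγ
    obtain ⟨a, b, -, -, h3, h4, h5⟩ := mem_groundGliders.1 hγ
    exact ⟨a, b, (isBaseHill_iff hx hn).2 ⟨h3, h4⟩, h5⟩
  have hsub : ∀ γ ∈ groundGliders (unroll x) p (p + n),
      γ.1 ⊆ Finset.Ioc p (p + n) ∧ γ.2 ⊆ Finset.Ioc p (p + n) := by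
    intro γ hγ
    simp only [groundGliders, Finset.mem_filter, Finset.mem_product, Finset.mem_powerset] at hγ
    exact hγ.1
  rw [numGliders, ← Fintype.card_coe, ← Nat.card_eq_fintype_card]
  symm
  refine Nat.card_eq_of_bijective
    (fun γ : groundGliders (unroll x) p (p + n) =>
      Quotient.mk (gliderSetoid x) ⟨γ.1, hmem γ.1 γ.2⟩) ⟨?_, ?_⟩
  · intro γ γ' h
    obtain ⟨h1, h2⟩ := Quotient.exact h
    have h3 := hsub γ.1 γ.2
    have h4 := hsub γ'.1 γ'.2
    exact Subtype.ext (Prod.ext (residues_injOn h3.1 h4.1 h1) (residues_injOn h3.2 h4.2 h2))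
  · intro c
    induction c using Quotient.inductionOn with
    | _ γ =>
      obtain ⟨γ, a, b, hab, hγ⟩ := γ
      obtain ⟨ha, hD⟩ := (isBaseHill_iff hx hn).1 hab
      have hn0 : (0 : ℤ) < n := by omega
      obtain ⟨s, hs, h1, h2⟩ : ∃ s : ℤ, (n : ℤ) ∣ s ∧ p ≤ a + s ∧ a + s < p + n := by
        -- Translating by this multiple of `n` replaces `a - p` by its remainder modulo `n`.
        refine ⟨-(n * ((a - p) / n)), (dvd_mul_right _ _).neg_right, ?_, ?_⟩
        · have := Int.mul_ediv_self_le (x := a - p) hn0.ne'; omega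
        · have := Int.lt_mul_ediv_self_add (x := a - p) hn0; omega
      have ha' := ha.shift s
      have hD' := hD.shift s
      have hγ' := hγ.shift s
      rw [unroll_shift x hs] at ha' hD' hγ'
      -- Otherwise the Dyck path would cross the record step `p + n + 1` and fall below its starting
      -- height.
      have hb : b + s ≤ p + n := by
        by_contra hc
        have h3 := (isRecord_congr x (i := p + 1) (j := p + n + 1) (by push_cast; simp)).1 hp
        have h4 := h3 (a + s) (by omega)
        have h5 := (isDyck_iff.1 hD').2.2 (p + n + 1) (by omega) (by omega)
        omega
      refine ⟨⟨(γ.1.image (· + s), γ.2.image (· + s)),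
        mem_groundGliders.2 ⟨a + s, b + s, h1, hb, ha', hD', hγ'⟩⟩, Quotient.sound ?_⟩
      exact ⟨residues_image_add γ.1 hs, residues_image_add γ.2 hs⟩

theorem descents_eq_numGliders {n k : ℕ} [NeZero n] {x : ZMod n → Bool}
    (hx : x ∈ bitstrings n k) (hn : 2 * k + 1 ≤ n) : descents x = numGliders x := by
  have hr := isRecord_firstUnmatched hx hn
  have hg := hr.ground_pred
  have hg' := hg.shift n
  rw [unroll_shift x dvd_rfl] at hg'
  have h1 := card_groundGliders (by omega) hg hg'
  have h2 := numGliders_eq_card hx hn (p := firstUnmatched x - 1) (by simpa using hr)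
  have h3 := descents_eq x (firstUnmatched x - 1)
  rw [← h1, ← h2] at h3
  exact_mod_cast h3

/-! ### Invariance under the map `f` -/

lemma mem_cyclicMatched_iff {n k : ℕ} [NeZero n] {x : ZMod n → Bool}
    (hx : x ∈ bitstrings n k) (hn : 2 * k + 1 ≤ n) (i : ℤ) :
    (i : ZMod n) ∈ cyclicMatched x ↔ ¬ IsRecord (unroll x) i := by
  have hW := height_add_period_lt hx hn
  constructor
  · rintro ⟨j, hj, hm⟩
    rw [mem_matched_iff hW] at hm
    rwa [isRecord_congr x hj.symm]
  · exact fun h => ⟨i, rfl, (mem_matched_iff hW).2 h⟩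

lemma f_eq_true_iff {n k : ℕ} [NeZero n] {x : ZMod n → Bool}
    (hx : x ∈ bitstrings n k) (hn : 2 * k + 1 ≤ n) (r : ZMod n) :
    f x r = true ↔ r ∈ cyclicMatched x ∧ x r = false := by
  obtain ⟨i, rfl⟩ := ZMod.intCast_surjective r
  unfold f
  by_cases h : (i : ZMod n) ∈ cyclicMatched x
  · simp [h]
  · have h1 : IsRecord (unroll x) i := by
      rwa [mem_cyclicMatched_iff hx hn, not_not] at h
    have h2 : x i = false := h1.bit
    simp [h, h2]

/-- The loss of 1s under `f` is the sum of the Motzkin steps over a period, and the path is on the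
ground at both ends of the chosen period. -/
lemma f_mem_bitstrings {n k : ℕ} [NeZero n] {x : ZMod n → Bool}
    (hx : x ∈ bitstrings n k) (hn : 2 * k + 1 ≤ n) : f x ∈ bitstrings n k := by
  have hW := height_add_period_lt hx hn
  rw [mem_bitstrings_iff, ← mem_bitstrings_iff.1 hx]
  obtain ⟨H, hH, hG⟩ := exists_reduced_height hW
  have hg := (isRecord_firstUnmatched hx hn).ground
  have hg' := hg.shift n
  rw [unroll_shift x dvd_rfl] at hg'
  have h1 := sum_Ioc_eq_sub hH (c := firstUnmatched x) (p := firstUnmatched x + n) (by omega)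
  rw [(hG _).2 hg, (hG _).2 hg', sub_zero] at h1
  rw [eq_comm, ← sub_eq_zero, ← Finset.sum_sub_distrib, ← sum_Ioc_period _ (firstUnmatched x : ℤ)]
  refine (Finset.sum_congr rfl fun i _ => ?_).trans h1
  have h2 := f_eq_true_iff hx hn i
  rw [mem_cyclicMatched_iff hx hn, ← mem_matched_iff hW] at h2
  have h3 : unroll x i = x i := rfl
  rw [motzkinStep, h3]
  by_cases h4 : i ∈ matched (unroll x)
  · rw [if_pos h4]
    simp only [h4, true_and] at h2
    cases h5 : x i <;> simp [h2, h5]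
  · rw [mem_matched_iff hW, not_not] at h4
    have h5 : x i = false := h4.bit
    rw [← not_not (a := IsRecord _ _), ← mem_matched_iff hW] at h4
    simp [h2, h4, h5]

lemma descents_f {n k : ℕ} [NeZero n] {x : ZMod n → Bool}
    (hx : x ∈ bitstrings n k) (hn : 2 * k + 1 ≤ n) : descents (f x) = descents x := by
  -- Equivalently, a 1 of `f x` at `r + 1` is preceded either by another 1 of `f x` or by the 1 of a
  -- descent of `x`, never both, and each descent of `x` arises so. Summed over `r`, the counts of
  -- 1s cancel.
  have key : ∀ r : ZMod n,
      ((if f x r = true ∧ f x (r + 1) = false then 1 else 0) : ℤ) - (if f x r = true then 1 else 0) =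
      (if x r = true ∧ x (r + 1) = false then 1 else 0) - if f x (r + 1) = true then 1 else 0 := by
    intro r
    obtain ⟨i, rfl⟩ := ZMod.intCast_surjective r
    have e : (i : ZMod n) + 1 = ((i + 1 : ℤ) : ZMod n) := by push_cast; rfl
    -- The 0 of a descent ends at the height where the preceding 1 began, so it is no record.
    have h1 : x i = true → x ((i : ZMod n) + 1) = false → f x ((i : ZMod n) + 1) = true := by
      intro h1 h2
      rw [f_eq_true_iff hx hn, e, mem_cyclicMatched_iff hx hn, ← e]
      refine ⟨fun hr => ?_, h2⟩
      have h3 := hr (i - 1) (by omega)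
      have h4 := hr.bit
      have h5 := height_of_true (w := unroll x) (i := i) h1
      have h6 := height_of_false h4
      rw [add_sub_cancel_right] at h6
      omega
    -- If `i` were a record, a 0 at `i + 1` would be one too, hence unmatched.
    have h2 : x i = false → f x ((i : ZMod n) + 1) = true → f x i = true := by
      intro h1 h2
      rw [f_eq_true_iff hx hn, e, mem_cyclicMatched_iff hx hn, ← e] at h2
      rw [f_eq_true_iff hx hn, mem_cyclicMatched_iff hx hn]
      refine ⟨fun hr => h2.1 ?_, h1⟩
      have h3 : unroll x (i + 1) = false := by rw [unroll, ← e]; exact h2.2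
      exact hr.ground.isRecord h3
    have h3 : f x i = true → x i = false := fun h => ((f_eq_true_iff hx hn _).1 h).2
    have h4 : f x ((i : ZMod n) + 1) = true → x ((i : ZMod n) + 1) = false :=
      fun h => ((f_eq_true_iff hx hn _).1 h).2
    generalize f x ((i : ZMod n) + 1) = u at *
    generalize f x (i : ZMod n) = v at *
    generalize x ((i : ZMod n) + 1) = s at *
    generalize x (i : ZMod n) = t at *
    revert u v s t
    decide
  have hsum := Finset.sum_congr rfl fun r (_ : r ∈ Finset.univ) => key r
  have hshift : (∑ r, if f x (r + 1) = true then (1 : ℤ) else 0) =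
      ∑ r, if f x r = true then (1 : ℤ) else 0 :=
    Equiv.sum_comp (Equiv.addRight (1 : ZMod n)) (fun r => if f x r = true then (1 : ℤ) else 0)
  rw [Finset.sum_sub_distrib, Finset.sum_sub_distrib, ← descents_eq_sum, ← descents_eq_sum,
    hshift] at hsum
  omega

end KneserGliders

theorem mainTheorem8 (n k : ℕ) (hn : 2 * k + 1 ≤ n) (x : ZMod n → Bool)
    (hx : x ∈ KneserGliders.bitstrings n k) :
    KneserGliders.descents x = KneserGliders.numGliders x ∧
      ∀ y ∈ KneserGliders.cycle x,
        KneserGliders.numGliders x = KneserGliders.numGliders y ∧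
          KneserGliders.descents x = KneserGliders.descents y := by
  have : NeZero n := ⟨by omega⟩
  -- Membership in `bitstrings n k` is carried along so that the equality of descents and gliders
  -- applies to every iterate.
  have key : ∀ t : ℕ, KneserGliders.f^[t] x ∈ KneserGliders.bitstrings n k ∧
      KneserGliders.descents (KneserGliders.f^[t] x) = KneserGliders.descents x := by
    intro t
    induction t with
    | zero => exact ⟨hx, rfl⟩
    | succ t ih =>
      rw [Function.iterate_succ_apply']
      exact ⟨KneserGliders.f_mem_bitstrings ih.1 hn, (KneserGliders.descents_f ih.1 hn).trans ih.2⟩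
  refine ⟨KneserGliders.descents_eq_numGliders hx hn, ?_⟩
  rintro y ⟨t, rfl⟩
  have h := key t
  refine ⟨?_, h.2.symm⟩
  rw [← KneserGliders.descents_eq_numGliders hx hn, ← KneserGliders.descents_eq_numGliders h.1 hn,
    h.2]
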